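/- There are numerical constants $c_0\in(0,1)$ and $K>0$ such that the following holds. Write points of $\mathbb{R}^{n}\times\mathbb{R}^{m}$ as $z=(x,y)$, with the Euclidean norm $\|\cdot\|_2$; for matrices, $\|\cdot\|_2$ is the spectral norm. Let $f$ be a real-valued, twice continuously differentiable function on a neighbourhood $D$ of $z^*=(x^*,y^*)$ in $\mathbb{R}^n\times\mathbb{R}^m$, and write $$\nabla^2 f(z^*)=\begin{pmatrix} C & B\\ B^\top & -A\end{pmatrix},\qquad C\in\mathbb{R}^{n\times n},\ B\in\mathbb{R}^{n\times m},\ A\in\mathbb{R}^{m\times m}.$$ Suppose that $z^*$ is a differential Stackelberg equilibrium of $f$ with parameters $(L,\mu,\mu_x)$, that is: $\nabla_x f(z^*)=0$, $\nabla_y f(z^*)=0$, $A$ and $C+BA^{-1}B^\top$ are positive definite, $\max\{\|A\|_2,\|B\|_2,\|C\|_2\}\le L$, $\mu=\lambda_{\min}(A)$ and $\mu_x=\min\{L,\lambda_{\min}(C+BA^{-1}B^\top)\}$. Put $\kappa=L/\mu$ and $\kappa_x=L/\mu_x$. Let $r\ge 2\kappa$, $\eta_x=\frac{1}{4rL}$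 and $\eta_y=\frac1{4L}$. Suppose that $$M=\begin{pmatrix}-C&-B\\ rB^\top&-rA\end{pmatrix}$$ is diagonalizable over $\mathbb{C}$, $M=P^{-1}\Lambda P$ with $P$ invertible and $\Lambda$ diagonal, and put $C_P=\|P\|_2\|P^{-1}\|_2$. Then there is $\delta>0$ such that for every $z^0$ with $\|z^0-z^*\|_2\le\delta$ the iterates $z^k=(x^k,y^k)$ of each of the following two methods are well defined (all points where the gradient is evaluated lie in the interior of $D$): - gradient descent ascent (GDA): $x^{k+1}=x^k-\eta_x\nabla_xf(z^k)$, $y^{k+1}=y^k+\eta_y\nabla_yf(z^k)$; - extra-gradient (EG): $x^{k+1/2}=x^k-\eta_x\nabla_xf(z^k)$, $y^{k+1/2}=y^k+\eta_y\nabla_yf(z^k)$, and then $x^{k+1}=x^k-\eta_x\nabla_xf(z^{k+1/2})$, $y^{k+1}=y^k+\eta_y\nabla_yf(z^{k+1/2})$; and they satisfy $$\|z^T-z^*\|_2\le C_P\,\|z^0-z^*\|_2\left(1-\frac{c_0}{r\kappa_x}\right)^T\qquad\text{for all } T\ge 0.$$ Consequently, for every $\varepsilon>0$, either method reaches, and keeps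 at all later iterations, an error $\|z^T-z^*\|_2<\varepsilon$ after at most $$K\max\left\{1,\; r\kappa_x\log\left(\frac{C_P\|z^0-z^*\|_2}{\varepsilon}\right)\right\}$$ gradient evaluations (one per iteration of GDA, two per iteration of EG; when $z^0=z^*$ the maximum is read as $1$). That is, the gradient complexity is $\mathcal{O}\left(r\kappa_x\log(C_P\|z^0-z^*\|_2/\varepsilon)\right)$. -/

import Mathlib

open scoped Matrix.Norms.L2Operator Topology

noncomputable section

namespace Minimax

/-- The space `ℝⁿ × ℝᵐ` of stacked vectors `z = (x, y)` with the Euclidean norm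
`‖z‖² = ‖x‖² + ‖y‖²`; the coordinates `Sum.inl i` form `x`, the coordinates `Sum.inr j` form `y`. -/
abbrev Point (n m : ℕ) : Type := EuclideanSpace ℝ (Fin n ⊕ Fin m)

variable {n m : ℕ}

/-- The partial gradient `∇ₓ f(z)`. -/
def gradX (f : Point n m → ℝ) (z : Point n m) : EuclideanSpace ℝ (Fin n) :=
  WithLp.toLp 2 fun i => gradient f z (Sum.inl i)

/-- The partial gradient `∇_y f(z)`. -/
def gradY (f : Point n m → ℝ) (z : Point n m) : EuclideanSpace ℝ (Fin m) :=
  WithLp.toLp 2 fun j => gradient f z (Sum.inr j)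

/-- The Hessian matrix `∇² f(z)`: the derivative (Jacobian matrix) of the gradient. -/
def hess (f : Point n m → ℝ) (z : Point n m) : Matrix (Fin n ⊕ Fin m) (Fin n ⊕ Fin m) ℝ :=
  Matrix.of fun i j => fderiv ℝ (gradient f) z (EuclideanSpace.single j 1) i

/-- `C = ∇²ₓₓ f(z)`. -/
def blockC (f : Point n m → ℝ) (z : Point n m) : Matrix (Fin n) (Fin n) ℝ :=
  (hess f z).toBlocks₁₁

/-- `B = ∇²ₓᵧ f(z)`. -/
def blockB (f : Point n m → ℝ) (z : Point n m) : Matrix (Fin n) (Fin m) ℝ :=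
  (hess f z).toBlocks₁₂

/-- `A = -∇²ᵧᵧ f(z)`. -/
def blockA (f : Point n m → ℝ) (z : Point n m) : Matrix (Fin m) (Fin m) ℝ :=
  -(hess f z).toBlocks₂₂

/-- The Schur complement `C + B A⁻¹ Bᵀ`. -/
def schur (f : Point n m → ℝ) (z : Point n m) : Matrix (Fin n) (Fin n) ℝ :=
  blockC f z + blockB f z * (blockA f z)⁻¹ * (blockB f z).transpose

/-- `z` is a differential Stackelberg equilibrium of `f`. -/
structure IsDifferentialStackelberg (f : Point n m → ℝ) (z : Point n m) : Prop where
  gradX_eq_zero : gradX f z = 0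
  gradY_eq_zero : gradY f z = 0
  posDef_A : (blockA f z).PosDef
  posDef_schur : (schur f z).PosDef

/-- `z` is a differential Stackelberg equilibrium of `f` with parameters `(L, μ, μₓ)`:
`max {‖A‖₂, ‖B‖₂, ‖C‖₂} ≤ L` (spectral norms), `μ = λ_min(A)` and
`μₓ = min {L, λ_min(C + B A⁻¹ Bᵀ)}`. -/
structure IsStackelbergWith (f : Point n m → ℝ) (z : Point n m) (L μ μx : ℝ) : Prop where
  stackelberg : IsDifferentialStackelberg f z
  smooth : max ‖blockA f z‖ (max ‖blockB f z‖ ‖blockC f z‖) ≤ L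
  mu_eq : IsLeast (spectrum ℝ (blockA f z)) μ
  mux_eq : ∃ l, IsLeast (spectrum ℝ (schur f z)) l ∧ μx = min L l

/-- The matrix `M = [[-C, -B], [r Bᵀ, -r A]]`. -/
def dynMatrix (f : Point n m → ℝ) (z : Point n m) (r : ℝ) :
    Matrix (Fin n ⊕ Fin m) (Fin n ⊕ Fin m) ℝ :=
  Matrix.fromBlocks (-blockC f z) (-blockB f z)
    (r • (blockB f z).transpose) (-(r • blockA f z))

/-- Starting from `z = (x, y)`, one descent step in `x` and one ascent step in `y` along the
gradient of `f` queried at `w`: `(x - ηx ∇ₓ f(w), y + ηy ∇_y f(w))`. -/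
def stepAlong (f : Point n m → ℝ) (ηx ηy : ℝ) (z w : Point n m) : Point n m :=
  WithLp.toLp 2 (Sum.elim (fun i => z (Sum.inl i) - ηx * gradX f w i)
    (fun j => z (Sum.inr j) + ηy * gradY f w j))

/-- A state of an algorithm: the current iterate and the number of calls made so far to the exact
gradient oracle, where one call returns `(∇ₓ f(w), ∇_y f(w))` at one point `w`. -/
structure RunState (n m : ℕ) where
  point : Point n m
  calls : ℕ

/-- Gradient descent ascent from `z₀`, after `k` iterations. An iteration queries the oracle
once, at the current iterate. -/
def gdaRun (f : Point n m → ℝ) (ηx ηy : ℝ) (z₀ : Point n m) : ℕ → RunState n m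
  | 0 => ⟨z₀, 0⟩
  | k + 1 =>
    let s := gdaRun f ηx ηy z₀ k
    ⟨stepAlong f ηx ηy s.point s.point, s.calls + 1⟩

/-- The intermediate point `z^{k+1/2}` of an extra-gradient iteration from `z = z^k`. -/
def egHalf (f : Point n m → ℝ) (ηx ηy : ℝ) (z : Point n m) : Point n m :=
  stepAlong f ηx ηy z z

/-- The extra-gradient method from `z₀`, after `k` iterations. An iteration queries the oracle
twice, at the current iterate and at the intermediate point. -/
def egRun (f : Point n m → ℝ) (ηx ηy : ℝ) (z₀ : Point n m) : ℕ → RunState n m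
  | 0 => ⟨z₀, 0⟩
  | k + 1 =>
    let s := egRun f ηx ηy z₀ k
    ⟨stepAlong f ηx ηy s.point (egHalf f ηx ηy s.point), s.calls + 2⟩

end Minimax

end

/-! Since `ηy = r * ηx`, the Jacobian of the GDA map at the equilibrium is `1 + ηx • M`, and that of
the EG map is `1 + ηx • M * (1 + ηx • M)`. Both are diagonalized by the same `P` as `M`, so the
proof reduces to locating the eigenvalues `λ` of `M`.

A real eigenvalue is controlled by eliminating `y`: this leaves a shifted Schur complement, which `r
* μ ≥ 2 * L` keeps close enough to the true one to force `λ ≤ -μx`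
(`SaddleForm.le_of_real_eigenvalue`). For a nonreal eigenvalue, the imaginary part of the
eigenvector equation balances the two blocks, `‖y‖² = r ‖x‖²`; the damping by `A` then outweighs any
negative curvature of `C`, so `Re λ ≤ -L / 2`, while `(Im λ)² ≤ r * L ^ 2`
(`SaddleForm.le_of_nonreal_eigenvalue`). In both cases `(Im λ)² ≤ 2 * r * L * (-Re λ)`: the
eigenvalues lie inside a parabola. There a step `1 / (4 * r * L)` yields multipliers of modulus at
most `1 - 1 / (16 * r * κx)` (`multiplier_bounds`).

In the norm `v ↦ ‖P v‖` the Jacobians contract at this rate. Near the equilibrium the nonlinear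
remainder costs half of the gap, and comparing norms costs the factor `‖P‖ * ‖P⁻¹‖` only once
(`exists_local_linear_convergence`). -/

noncomputable section

namespace Minimax

/-! ### Location of the eigenvalues of the saddle dynamics -/

section Spectrum

variable {E F : Type*} [NormedAddCommGroup E] [InnerProductSpace ℝ E]
  [NormedAddCommGroup F] [InnerProductSpace ℝ F]

open RealInnerProductSpace

/-- A quadratic saddle `½⟪x, C x⟫ + ⟪x, B y⟫ - ½⟪y, A y⟫` whose blocks are bounded by `L`, with
`A ≥ μ` and Schur complement at least `μx`. -/
structure SaddleForm (C : E →ₗ[ℝ] E) (B : F →ₗ[ℝ] E) (B' : E →ₗ[ℝ] F) (A : F →ₗ[ℝ] F)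
    (L μ μx : ℝ) : Prop where
  symm_C : ∀ x x', ⟪C x, x'⟫ = ⟪x, C x'⟫
  symm_A : ∀ y y', ⟪A y, y'⟫ = ⟪y, A y'⟫
  adjoint_B : ∀ x y, ⟪x, B y⟫ = ⟪B' x, y⟫
  abs_C_le : ∀ x, |⟪x, C x⟫| ≤ L * ‖x‖ ^ 2
  abs_B_le : ∀ x y, |⟪x, B y⟫| ≤ L * (‖x‖ * ‖y‖)
  le_A : ∀ y, μ * ‖y‖ ^ 2 ≤ ⟪y, A y⟫
  A_le : ∀ y, ⟪y, A y⟫ ≤ L * ‖y‖ ^ 2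
  le_schur : ∀ x, ∃ h, A h = B' x ∧ μx * ‖x‖ ^ 2 ≤ ⟪x, C x⟫ + ⟪h, A h⟫
  mu_pos : 0 < μ
  mux_pos : 0 < μx
  mu_le : μ ≤ L
  mux_le : μx ≤ L

variable {C : E →ₗ[ℝ] E} {B : F →ₗ[ℝ] E} {B' : E →ₗ[ℝ] F} {A : F →ₗ[ℝ] F} {L μ μx r : ℝ}

/-- With `w = α / r`, the second equation reads `(A + w) y = B' x`, so `x` is a null vector of `C +
B (A + w)⁻¹ B' + α`. The upper bound compares this with the Schur complement, the case `w = 0`; the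
lower bound comes from the norm `r ‖x‖² + ‖y‖²`, in which the coupling terms cancel. -/
theorem SaddleForm.le_of_real_eigenvalue (S : SaddleForm C B B' A L μ μx) (hr : 2 * L ≤ r * μ)
    {α : ℝ} {x : E} {y : F} (hx : -C x - B y = α • x) (hy : r • (B' x - A y) = α • y)
    (hne : x ≠ 0 ∨ y ≠ 0) : α ≤ -μx ∧ -(r * L) ≤ α := by
  obtain ⟨hsC, hsA, hB, hC, hBn, hA, hA', hS, hμ, hμx, hμL, hμxL⟩ := S
  have hr0 : 0 < r := by
    by_contra h
    nlinarith only [h, hr, hμ, hμL]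
  have hr2 : 2 ≤ r := by
    by_contra h
    nlinarith only [h, hr, hμ, hμL]
  have ex : -⟪x, C x⟫ - ⟪x, B y⟫ = α * ‖x‖ ^ 2 := by
    have := congrArg (fun v => ⟪x, v⟫) hx
    simpa [inner_sub_right, inner_smul_right] using this
  have ey : r * (⟪B' x, y⟫ - ⟪y, A y⟫) = α * ‖y‖ ^ 2 := by
    have := congrArg (fun v => ⟪y, v⟫) hy
    simpa [inner_sub_right, inner_smul_right, real_inner_comm] using this
  have hb := hB x y
  have hcx := abs_le.1 (hC x)
  have hAy := hA y
  have hAy' := hA' y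
  have hX : 0 ≤ ‖x‖ ^ 2 := sq_nonneg _
  have hY : 0 ≤ ‖y‖ ^ 2 := sq_nonneg _
  have hXY : 0 < r * ‖x‖ ^ 2 + ‖y‖ ^ 2 := by
    rcases hne with h | h
    · have : 0 < ‖x‖ ^ 2 := by positivity
      positivity
    · have : 0 < ‖y‖ ^ 2 := by positivity
      positivity
  refine ⟨?_, ?_⟩
  · by_contra! hlt
    set w := α / r with hw
    have hα : α = r * w := by rw [hw]; field_simp
    have hwμ : 0 < μ + w := by
      have : 0 < r * (μ + w) := by nlinarith
      exact (mul_pos_iff_of_pos_left hr0).1 this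
    -- `h` plays the role of `A⁻¹ B' x`, and `h - y` measures the effect of the shift `w`.
    obtain ⟨h, hh, hSx⟩ := hS x
    have hg : A (h - y) = w • y := by
      rw [hα, mul_smul] at hy
      have := smul_right_injective F hr0.ne' hy
      simpa [hh] using this
    have ey' : ⟪B' x, y⟫ - ⟪y, A y⟫ = w * ‖y‖ ^ 2 := by
      rw [hα] at ey
      have : r * (⟪B' x, y⟫ - ⟪y, A y⟫) = r * (w * ‖y‖ ^ 2) := by linarith
      exact mul_left_cancel₀ hr0.ne' this
    have e1 : ⟪h - y, A (h - y)⟫ = w * ⟪h - y, y⟫ := by rw [hg, inner_smul_right]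
    have e2 : ⟪h, A h⟫ = ⟪y, A y⟫ + 2 * w * ‖y‖ ^ 2 + ⟪h - y, A (h - y)⟫ := by
      have : h = y + (h - y) := by abel
      have k : ⟪h, A h⟫ = ⟪y + (h - y), A (y + (h - y))⟫ := by rw [← this]
      have k2 : ⟪h - y, A y⟫ = w * ‖y‖ ^ 2 := by
        rw [← hsA, hg, inner_smul_left, real_inner_self_eq_norm_sq]; simp
      have k3 : ⟪y, A (h - y)⟫ = w * ‖y‖ ^ 2 := by
        rw [hg, inner_smul_right, real_inner_self_eq_norm_sq]
      rw [k, map_add, inner_add_left, inner_add_right, inner_add_right, k2, k3]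
      ring
    have e3 : ⟪h - y, A (h - y)⟫ * μ ≤ w ^ 2 * ‖y‖ ^ 2 := by
      have k1 := hA (h - y)
      have k2 : ⟪h - y, A (h - y)⟫ ≤ |w| * (‖h - y‖ * ‖y‖) := by
        rw [e1]
        refine (le_abs_self _).trans ?_
        rw [abs_mul]
        exact mul_le_mul_of_nonneg_left (abs_real_inner_le_norm _ _) (abs_nonneg _)
      have k3 : μ * ‖h - y‖ ≤ |w| * ‖y‖ := by
        rcases (norm_nonneg (h - y)).eq_or_lt' with h0 | h0
        · rw [h0]; simp; positivity
        · have : μ * ‖h - y‖ * ‖h - y‖ ≤ |w| * ‖y‖ * ‖h - y‖ := by nlinarith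
          exact le_of_mul_le_mul_right this h0
      calc _ ≤ (|w| * (‖h - y‖ * ‖y‖)) * μ := by gcongr
        _ = (|w| * ‖y‖) * (μ * ‖h - y‖) := by ring
        _ ≤ (|w| * ‖y‖) * (|w| * ‖y‖) := by gcongr
        _ = |w| ^ 2 * ‖y‖ ^ 2 := by ring
        _ = w ^ 2 * ‖y‖ ^ 2 := by rw [sq_abs]
    have hx0 : 0 < ‖x‖ ^ 2 := by
      rcases hX.eq_or_lt' with h0 | h0
      · have : x = 0 := by simpa using h0
        subst this
        have : (μ + w) * ‖y‖ ^ 2 ≤ 0 := by simp at ey'; nlinarith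
        have : ‖y‖ ^ 2 ≤ 0 := nonpos_of_mul_nonpos_right this hwμ
        simp only [norm_zero] at hXY
        linarith
      · exact h0
    have key : -α * ‖x‖ ^ 2 + w * ‖y‖ ^ 2 + ⟪h - y, A (h - y)⟫ ≥ μx * ‖x‖ ^ 2 := by linarith
    -- By `e3` the correction to the Schur form is at most `w (μ + w) / μ * ‖y‖²`. For `w < 0` it is
    -- nonpositive. For `w ≥ 0` it is at most `α / 2 * ‖x‖²`, because `2 * L ≤ r * μ`, which leaves
    -- `μx ≤ -α / 2 ≤ 0`.
    rcases lt_or_ge w 0 with hneg | hpos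
    · have : w * ‖y‖ ^ 2 + ⟪h - y, A (h - y)⟫ ≤ 0 := by
        have : μ * (w * ‖y‖ ^ 2 + ⟪h - y, A (h - y)⟫) ≤ 0 := by
          have : w * (μ + w) * ‖y‖ ^ 2 ≤ 0 :=
            mul_nonpos_of_nonpos_of_nonneg (mul_nonpos_of_nonpos_of_nonneg hneg.le hwμ.le) hY
          linarith
        exact nonpos_of_mul_nonpos_right this hμ
      have : μx * ‖x‖ ^ 2 ≤ -α * ‖x‖ ^ 2 := by linarith
      have := le_of_mul_le_mul_right this hx0
      linarith
    · have k1 : (μ + w) * ‖y‖ ^ 2 ≤ L * ‖x‖ ^ 2 := by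
        have : 0 ≤ α * ‖x‖ ^ 2 := by rw [hα]; positivity
        nlinarith
      have k2 : μ * (w * ‖y‖ ^ 2 + ⟪h - y, A (h - y)⟫) ≤ w * (L * ‖x‖ ^ 2) := by
        have := mul_le_mul_of_nonneg_left k1 hpos
        linarith
      have k3 : 2 * (w * (L * ‖x‖ ^ 2)) ≤ μ * (α * ‖x‖ ^ 2) := by
        rw [hα]
        have := mul_le_mul_of_nonneg_right hr (show 0 ≤ w * ‖x‖ ^ 2 by positivity)
        linarith
      have k4 : 0 < μ * (μx * ‖x‖ ^ 2) := by positivity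
      have k5 : 0 ≤ μ * (α * ‖x‖ ^ 2) := by rw [hα]; positivity
      have := mul_le_mul_of_nonneg_left key hμ.le
      linarith
  · have : -(r * L) * (r * ‖x‖ ^ 2 + ‖y‖ ^ 2) ≤ α * (r * ‖x‖ ^ 2 + ‖y‖ ^ 2) := by
      have e : α * (r * ‖x‖ ^ 2 + ‖y‖ ^ 2) = -r * ⟪x, C x⟫ - r * ⟪y, A y⟫ := by
        rw [hb] at ex
        linear_combination (-r) * ex - ey
      have k1 := mul_le_mul_of_nonneg_left hcx.2 hr0.le
      have k2 := mul_le_mul_of_nonneg_left hAy' hr0.le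
      have k3 : 0 ≤ (r - 1) * (r * (L * ‖x‖ ^ 2)) :=
        mul_nonneg (by linarith) (mul_nonneg hr0.le (mul_nonneg (by linarith) hX))
      have k4 : 0 ≤ L * ‖y‖ ^ 2 := mul_nonneg (by linarith) hY
      linarith
    exact le_of_mul_le_mul_right this hXY

/-- The symmetric blocks drop out of the imaginary part of the quadratic form, and the two coupling
contributions agree up to the factor `r`. Dividing by `β ≠ 0` gives `Y = r * X`. With this balance
the coupling also drops out of the real part, and Cauchy–Schwarz on the coupling bounds `β`. -/
theorem SaddleForm.le_of_nonreal_eigenvalue (S : SaddleForm C B B' A L μ μx) (hr : 2 * L ≤ r * μ)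
    {α β : ℝ} {x x' : E} {y y' : F}
    (h₁ : -C x - B y = α • x - β • x') (h₂ : -C x' - B y' = β • x + α • x')
    (h₃ : r • (B' x - A y) = α • y - β • y') (h₄ : r • (B' x' - A y') = β • y + α • y')
    (hne : (x ≠ 0 ∨ y ≠ 0) ∨ (x' ≠ 0 ∨ y' ≠ 0)) (hβ : β ≠ 0) :
    α ≤ -(L / 2) ∧ -(r * L) ≤ α ∧ β ^ 2 ≤ r * L ^ 2 := by
  obtain ⟨hsC, hsA, hB, hC, hBn, hA, hA', hS, hμ, hμx, hμL, hμxL⟩ := S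
  have hr0 : 0 < r := by
    by_contra h
    nlinarith only [h, hr, hμ, hμL]
  have hr2 : 2 ≤ r := by
    by_contra h
    nlinarith only [h, hr, hμ, hμL]
  set X := ‖x‖ ^ 2 + ‖x'‖ ^ 2 with hX
  set Y := ‖y‖ ^ 2 + ‖y'‖ ^ 2 with hY
  have e1 : ∀ v, -⟪v, C x⟫ - ⟪v, B y⟫ = α * ⟪v, x⟫ - β * ⟪v, x'⟫ := fun v => by
    have := congrArg (fun u => ⟪v, u⟫) h₁
    simpa [inner_sub_right, inner_smul_right] using this
  have e2 : ∀ v, -⟪v, C x'⟫ - ⟪v, B y'⟫ = β * ⟪v, x⟫ + α * ⟪v, x'⟫ := fun v => by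
    have := congrArg (fun u => ⟪v, u⟫) h₂
    simpa [inner_sub_right, inner_add_right, inner_smul_right] using this
  have e3 : ∀ v, r * (⟪x, B v⟫ - ⟪v, A y⟫) = α * ⟪v, y⟫ - β * ⟪v, y'⟫ := fun v => by
    have := congrArg (fun u => ⟪v, u⟫) h₃
    simpa [inner_sub_right, inner_smul_right, hB, real_inner_comm] using this
  have e4 : ∀ v, r * (⟪x', B v⟫ - ⟪v, A y'⟫) = β * ⟪v, y⟫ + α * ⟪v, y'⟫ := fun v => by
    have := congrArg (fun u => ⟪v, u⟫) h₄
    simpa [inner_sub_right, inner_add_right, inner_smul_right, hB, real_inner_comm] using this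
  have cC : ⟪x', C x⟫ = ⟪x, C x'⟫ := by rw [← hsC, real_inner_comm]
  have cA : ⟪y', A y⟫ = ⟪y, A y'⟫ := by rw [← hsA, real_inner_comm]
  have cx : ⟪x', x⟫ = ⟪x, x'⟫ := real_inner_comm _ _
  have cy : ⟪y', y⟫ = ⟪y, y'⟫ := real_inner_comm _ _
  have nx := real_inner_self_eq_norm_sq x
  have nx' := real_inner_self_eq_norm_sq x'
  have ny := real_inner_self_eq_norm_sq y
  have ny' := real_inner_self_eq_norm_sq y'
  have b1 : β * X = ⟪x', B y⟫ - ⟪x, B y'⟫ := by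
    have k1 := e1 x'
    have k2 := e2 x
    rw [cC, cx, nx'] at k1
    rw [nx] at k2
    rw [hX]
    linarith
  have b2 : β * Y = r * (β * X) := by
    have k1 := e3 y'
    have k2 := e4 y
    rw [cA, cy, ny'] at k1
    rw [ny] at k2
    rw [b1, hY]
    linarith
  have hYX : Y = r * X := by
    apply mul_left_cancel₀ hβ
    linarith
  have hX0 : 0 < X := by
    have hXn : 0 ≤ X := by positivity
    rcases hXn.eq_or_lt' with h0 | h0
    · exfalso
      have hY0 : Y = 0 := by rw [hYX, h0, mul_zero]
      have q1 : ‖x‖ ^ 2 = 0 := by linarith [sq_nonneg ‖x‖, sq_nonneg ‖x'‖]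
      have q2 : ‖x'‖ ^ 2 = 0 := by linarith [sq_nonneg ‖x‖, sq_nonneg ‖x'‖]
      have q3 : ‖y‖ ^ 2 = 0 := by linarith [sq_nonneg ‖y‖, sq_nonneg ‖y'‖]
      have q4 : ‖y'‖ ^ 2 = 0 := by linarith [sq_nonneg ‖y‖, sq_nonneg ‖y'‖]
      simp at q1 q2 q3 q4
      simp [q1, q2, q3, q4] at hne
    · exact h0
  have hα : 2 * α * X = -(⟪x, C x⟫ + ⟪x', C x'⟫) - (⟪y, A y⟫ + ⟪y', A y'⟫) := by
    have k1 := e1 x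
    have k2 := e2 x'
    have k3 := e3 y
    have k4 := e4 y'
    rw [nx] at k1
    rw [nx', cx] at k2
    rw [ny] at k3
    rw [ny', cy] at k4
    have : r * (2 * α * X) = r * (-(⟪x, C x⟫ + ⟪x', C x'⟫) - (⟪y, A y⟫ + ⟪y', A y'⟫)) := by
      have : r * (2 * α * X) = r * (α * X) + α * Y := by rw [hYX]; ring
      rw [this, hX, hY]
      linear_combination (-r) * k1 + (-r) * k2 - k3 - k4
    exact mul_left_cancel₀ hr0.ne' this
  have c1 := abs_le.1 (hC x)
  have c2 := abs_le.1 (hC x')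
  have a1 := hA y
  have a2 := hA y'
  have a3 := hA' y
  have a4 := hA' y'
  refine ⟨?_, ?_, ?_⟩
  · have : 2 * α * X ≤ L * X - μ * Y := by rw [hα, hX, hY]; linarith
    rw [hYX] at this
    have : α * X ≤ -(L / 2) * X := by
      have := mul_le_mul_of_nonneg_right hr hX0.le
      linarith
    exact le_of_mul_le_mul_right this hX0
  · have : -(L * X) - L * Y ≤ 2 * α * X := by rw [hα, hX, hY]; linarith
    rw [hYX] at this
    have hLX : 0 < L * X := mul_pos (by linarith) hX0
    have : -(r * L) * X ≤ α * X := by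
      have := mul_le_mul_of_nonneg_right hr2 hLX.le
      linarith
    exact le_of_mul_le_mul_right this hX0
  · have hL : 0 < L := by linarith
    have k : |β * X| ≤ L * (‖x'‖ * ‖y‖ + ‖x‖ * ‖y'‖) := by
      rw [b1]
      have := abs_sub (⟪x', B y⟫) (⟪x, B y'⟫)
      have := hBn x' y
      have := hBn x y'
      linarith
    have k2 : (‖x'‖ * ‖y‖ + ‖x‖ * ‖y'‖) ^ 2 ≤ X * Y := by
      rw [hX, hY]
      nlinarith [sq_nonneg (‖x‖ * ‖y‖ - ‖x'‖ * ‖y'‖)]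
    have k3 : β ^ 2 * X ^ 2 ≤ r * L ^ 2 * X ^ 2 := by
      calc β ^ 2 * X ^ 2 = |β * X| ^ 2 := by rw [sq_abs]; ring
        _ ≤ (L * (‖x'‖ * ‖y‖ + ‖x‖ * ‖y'‖)) ^ 2 := by gcongr
        _ = L ^ 2 * (‖x'‖ * ‖y‖ + ‖x‖ * ‖y'‖) ^ 2 := by ring
        _ ≤ L ^ 2 * (X * Y) := by gcongr
        _ = _ := by rw [hYX]; ring
    exact le_of_mul_le_mul_right k3 (by positivity)

/-- The location of an eigenvalue `α + iβ` with eigenvector `(x + ix', y + iy')`. -/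
theorem SaddleForm.eigenvalue_bounds (S : SaddleForm C B B' A L μ μx) (hr : 2 * L ≤ r * μ)
    {α β : ℝ} {x x' : E} {y y' : F}
    (h₁ : -C x - B y = α • x - β • x') (h₂ : -C x' - B y' = β • x + α • x')
    (h₃ : r • (B' x - A y) = α • y - β • y') (h₄ : r • (B' x' - A y') = β • y + α • y')
    (hne : (x ≠ 0 ∨ y ≠ 0) ∨ (x' ≠ 0 ∨ y' ≠ 0)) :
    α ≤ -(μx / 2) ∧ -(r * L) ≤ α ∧ β ^ 2 ≤ 2 * r * L * (-α) := by
  have hμx := S.mux_pos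
  have hμxL := S.mux_le
  have hL : 0 < L := hμx.trans_le hμxL
  have hr0 : 0 < r := by
    by_contra h
    nlinarith [S.mu_pos]
  by_cases hβ : β = 0
  · subst hβ
    simp only [zero_smul, sub_zero, zero_add] at h₁ h₂ h₃ h₄
    have : α ≤ -μx ∧ -(r * L) ≤ α := by
      rcases hne with h | h
      · exact S.le_of_real_eigenvalue hr h₁ h₃ h
      · exact S.le_of_real_eigenvalue hr h₂ h₄ h
    refine ⟨by linarith, this.2, ?_⟩
    have : 0 ≤ -α := by linarith
    simp only [ne_eq, OfNat.ofNat_ne_zero, not_false_eq_true, zero_pow]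
    positivity
  · obtain ⟨q1, q2, q3⟩ := S.le_of_nonreal_eigenvalue hr h₁ h₂ h₃ h₄ hne hβ
    -- `r * L ^ 2 = 2 * r * L * (L / 2)`, and `L / 2 ≤ -α`.
    refine ⟨by linarith, q2, q3.trans ?_⟩
    have := mul_le_mul_of_nonneg_left q1 (show 0 ≤ r * L by positivity)
    linarith

end Spectrum

/-! ### Moduli of the scalar multipliers -/

theorem norm_one_add_le {s : ℂ} {t : ℝ} (ht : s.re = -t) (h0 : 0 ≤ t) (h1 : t ≤ 1 / 4)
    (hq : s.im ^ 2 ≤ t / 2) : ‖1 + s‖ ≤ 1 - t / 2 := by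
  refine le_of_sq_le_sq ?_ (by linarith)
  rw [← Complex.normSq_eq_norm_sq, Complex.normSq_apply]
  simp only [Complex.add_re, Complex.one_re, Complex.add_im, Complex.one_im, ht]
  nlinarith

theorem norm_one_add_add_sq_le {s : ℂ} {t : ℝ} (ht : s.re = -t) (h0 : 0 ≤ t) (h1 : t ≤ 1 / 4)
    (hq : s.im ^ 2 ≤ t / 2) : ‖1 + s * (1 + s)‖ ≤ 1 - t / 2 := by
  refine le_of_sq_le_sq ?_ (by linarith)
  rw [← Complex.normSq_eq_norm_sq, Complex.normSq_apply]
  simp only [Complex.add_re, Complex.one_re, Complex.add_im, Complex.one_im, Complex.mul_re,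
    Complex.mul_im, ht]
  -- The squared modulus is `(1 - t + t ^ 2) ^ 2` minus this quantity, so here the imaginary part
  -- only helps.
  have k : 0 ≤ s.im ^ 2 * (1 + 2 * t - 2 * t ^ 2 - s.im ^ 2) :=
    mul_nonneg (sq_nonneg _) (by nlinarith)
  have k2 : (1 - t + t ^ 2) ^ 2 ≤ (1 - t / 2) ^ 2 := by
    apply pow_le_pow_left₀ <;> nlinarith
  nlinarith

/-! ### Local convergence and iteration count -/

/-- Local linear convergence at a fixed point, in the norm `v ↦ ‖N v‖`. -/
theorem exists_local_linear_convergence {E W : Type*} [NormedAddCommGroup E] [NormedSpace ℝ E]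
    [NormedAddCommGroup W] {Φ : E → E} {J : E →L[ℝ] E} {zs : E} {N : E →+ W} {a b ρ₀ ρ : ℝ}
    (hfix : Φ zs = zs) (hΦ : HasFDerivAt Φ J zs) (ha : 0 ≤ a) (hb : 0 ≤ b)
    (hNa : ∀ v, ‖N v‖ ≤ a * ‖v‖) (hNb : ∀ v, ‖v‖ ≤ b * ‖N v‖)
    (hJ : ∀ v, ‖N (J v)‖ ≤ ρ₀ * ‖N v‖) (hρ₀ : ρ₀ < ρ) (hρ : 0 ≤ ρ) (hρ1 : ρ ≤ 1)
    {U : Set E} (hU : U ∈ 𝓝 zs) :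
    ∃ δ > 0, ∀ z : ℕ → E, (∀ k, z (k + 1) = Φ (z k)) → ‖z 0 - zs‖ ≤ δ →
      ∀ T, z T ∈ U ∧ ‖z T - zs‖ ≤ a * b * ‖z 0 - zs‖ * ρ ^ T := by
  have hab : 0 ≤ a * b := mul_nonneg ha hb
  have hc : 0 < (ρ - ρ₀) / (a * b + 1) := div_pos (sub_pos.2 hρ₀) (by linarith)
  -- Measured by `N`, a remainder of relative size `(ρ - ρ₀) / (a * b + 1)` grows by at most `a *
  -- b`, so it fits in the gap `ρ - ρ₀`. The `+ 1` avoids division by zero.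
  obtain ⟨R, hR, hball⟩ := Metric.eventually_nhds_iff.1 ((hΦ.isLittleO.def hc).and hU)
  refine ⟨R / (2 * (a * b + 1)), by positivity, fun z hz hz0 => ?_⟩
  have hclose : ∀ T, ‖N (z T - zs)‖ ≤ ρ ^ T * (a * ‖z 0 - zs‖) →
      ‖z T - zs‖ ≤ a * b * ‖z 0 - zs‖ * ρ ^ T ∧ dist (z T) zs < R := by
    intro T hT
    have h1 : ‖z T - zs‖ ≤ a * b * ‖z 0 - zs‖ * ρ ^ T :=
      calc _ ≤ b * ‖N (z T - zs)‖ := hNb _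
        _ ≤ b * (ρ ^ T * (a * ‖z 0 - zs‖)) := by gcongr
        _ = _ := by ring
    refine ⟨h1, ?_⟩
    rw [dist_eq_norm]
    have h2 : a * b * ‖z 0 - zs‖ * ρ ^ T ≤ a * b * ‖z 0 - zs‖ :=
      mul_le_of_le_one_right (by positivity) (pow_le_one₀ hρ hρ1)
    have h3 : a * b * ‖z 0 - zs‖ ≤ (a * b + 1) * (R / (2 * (a * b + 1))) := by
      gcongr
      linarith
    have h4 : (a * b + 1) * (R / (2 * (a * b + 1))) = R / 2 := by
      field_simp
    linarith
  have hN : ∀ T, ‖N (z T - zs)‖ ≤ ρ ^ T * (a * ‖z 0 - zs‖) := by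
    intro T
    induction T with
    | zero => simpa only [pow_zero, one_mul] using hNa (z 0 - zs)
    | succ T ih =>
      have h1 := (hball (hclose T ih).2).1
      rw [hfix] at h1
      have h2 : z (T + 1) - zs = J (z T - zs) + (Φ (z T) - zs - J (z T - zs)) := by
        rw [hz]; abel
      have h3 : a * ((ρ - ρ₀) / (a * b + 1) * ‖z T - zs‖) ≤ (ρ - ρ₀) * ‖N (z T - zs)‖ := by
        calc _ ≤ a * ((ρ - ρ₀) / (a * b + 1) * (b * ‖N (z T - zs)‖)) := by
              gcongr
              exact hNb _
          _ = (ρ - ρ₀) * ‖N (z T - zs)‖ * (a * b / (a * b + 1)) := by ring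
          _ ≤ (ρ - ρ₀) * ‖N (z T - zs)‖ * 1 := by
              have : 0 ≤ (ρ - ρ₀) * ‖N (z T - zs)‖ :=
                mul_nonneg (sub_pos.2 hρ₀).le (norm_nonneg _)
              gcongr
              exact div_le_one_of_le₀ (by linarith) (by linarith)
          _ = _ := mul_one _
      calc ‖N (z (T + 1) - zs)‖ ≤ ‖N (J (z T - zs))‖ + ‖N (Φ (z T) - zs - J (z T - zs))‖ := by
            rw [h2, map_add]; exact norm_add_le _ _
        _ ≤ ρ₀ * ‖N (z T - zs)‖ + a * ((ρ - ρ₀) / (a * b + 1) * ‖z T - zs‖) := by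
            refine add_le_add (hJ _) ((hNa _).trans ?_)
            gcongr
        _ ≤ ρ * ‖N (z T - zs)‖ := by linarith
        _ ≤ ρ * (ρ ^ T * (a * ‖z 0 - zs‖)) := by gcongr
        _ = _ := by ring
  exact fun T => ⟨(hball (hclose T (hN T)).2).2, (hclose T (hN T)).1⟩

/-- Iteration complexity of linear convergence with rate `1 - c / q`. -/
theorem exists_iteration_bound {c q d : ℝ} (hc : 0 < c) (hc1 : c ≤ 1) (hq : 1 ≤ q)
    {e : ℕ → ℝ} (he : ∀ T, e T ≤ d * (1 - c / q) ^ T) {ε : ℝ} (hε : 0 < ε) :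
    ∃ T : ℕ, (T : ℝ) ≤ (1 / c + 1) * max 1 (q * Real.log (d / ε)) ∧ ∀ T', T ≤ T' → e T' < ε := by
  have hq0 : 0 < q := by linarith
  have hcq : c / q ≤ 1 := (div_le_one hq0).2 (hc1.trans hq)
  have hcq0 : 0 < c / q := by positivity
  rcases lt_or_ge d ε with hd | hd
  · refine ⟨0, ?_, fun T' _ => ?_⟩
    · have := le_max_left 1 (q * Real.log (d / ε))
      simp only [Nat.cast_zero]
      positivity
    · have h1 : (1 - c / q) ^ T' ≤ 1 := pow_le_one₀ (by linarith) (by linarith)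
      have h0 : 0 ≤ (1 - c / q) ^ T' := pow_nonneg (by linarith) _
      rcases le_or_gt d 0 with hd0 | hd0
      · exact ((he T').trans (mul_nonpos_of_nonpos_of_nonneg hd0 h0)).trans_lt hε
      · exact ((he T').trans (mul_le_of_le_one_right hd0.le h1)).trans_lt hd
  · have hd0 : 0 < d := hε.trans_le hd
    set X := Real.log (d / ε) with hX
    have hX0 : 0 ≤ X := Real.log_nonneg ((one_le_div hε).2 hd)
    have hm : 0 ≤ q * X / c := by positivity
    -- Adding one makes `T' > q * X / c` strict, as needed for the strict error bound; it also
    -- accounts for the `+ 1` in `1 / c + 1`.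
    refine ⟨⌊q * X / c⌋₊ + 1, ?_, fun T' hT' => (he T').trans_lt ?_⟩
    · push_cast
      have h1 := Nat.floor_le hm
      have h2 := le_max_left 1 (q * X)
      have h3 := le_max_right 1 (q * X)
      have h4 : q * X / c ≤ 1 / c * max 1 (q * X) := by
        rw [div_mul_eq_mul_div, one_mul]
        gcongr
      linarith
    · have h1 : q * X / c < T' := (Nat.lt_floor_add_one _).trans_le (by exact_mod_cast hT')
      have h2 : X < T' * (c / q) := by
        rw [div_lt_iff₀ hc] at h1
        rw [← mul_div_assoc, lt_div_iff₀ hq0]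
        linarith
      have h3 : (1 - c / q) ^ T' ≤ Real.exp (-(T' * (c / q))) := by
        calc (1 - c / q) ^ T' ≤ Real.exp (-(c / q)) ^ T' := by
              refine pow_le_pow_left₀ (by linarith) ?_ _
              have := Real.add_one_le_exp (-(c / q))
              linarith
          _ = _ := by rw [← Real.exp_nat_mul]; ring_nf
      have h4 : Real.exp (-(T' * (c / q))) < ε / d := by
        calc _ < Real.exp (-X) := Real.exp_lt_exp.2 (by linarith)
          _ = ε / d := by rw [Real.exp_neg, hX, Real.exp_log (by positivity), inv_div]
      calc d * (1 - c / q) ^ T' ≤ d * Real.exp (-(T' * (c / q))) := by gcongr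
        _ < d * (ε / d) := by gcongr
        _ = ε := by field_simp

/-! ### From matrix blocks to the quadratic saddle form -/

section Blocks

open RealInnerProductSpace Matrix

theorem inner_toEuclideanLin {k l : ℕ} (A : Matrix (Fin k) (Fin l) ℝ)
    (x : EuclideanSpace ℝ (Fin k)) (y : EuclideanSpace ℝ (Fin l)) :
    ⟪x, toEuclideanLin A y⟫ = x.ofLp ⬝ᵥ A *ᵥ y.ofLp := by
  rw [EuclideanSpace.inner_eq_star_dotProduct, dotProduct_comm]
  rfl

theorem inner_toEuclideanLin_eq_transpose {k l : ℕ} (A : Matrix (Fin k) (Fin l) ℝ)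
    (x : EuclideanSpace ℝ (Fin k)) (y : EuclideanSpace ℝ (Fin l)) :
    ⟪x, toEuclideanLin A y⟫ = ⟪toEuclideanLin Aᵀ x, y⟫ := by
  rw [real_inner_comm y, inner_toEuclideanLin, inner_toEuclideanLin, dotProduct_mulVec,
    ← mulVec_transpose, dotProduct_comm]

theorem abs_inner_toEuclideanLin_le {k l : ℕ} (A : Matrix (Fin k) (Fin l) ℝ)
    (x : EuclideanSpace ℝ (Fin k)) (y : EuclideanSpace ℝ (Fin l)) :
    |⟪x, toEuclideanLin A y⟫| ≤ ‖A‖ * (‖x‖ * ‖y‖) := by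
  calc _ ≤ ‖x‖ * ‖toEuclideanLin A y‖ := abs_real_inner_le_norm _ _
    _ ≤ ‖x‖ * (‖A‖ * ‖y‖) := by gcongr; exact A.l2_opNorm_mulVec y
    _ = _ := by ring

theorem le_inner_toEuclideanLin_of_isLeast_spectrum {k : ℕ} {A : Matrix (Fin k) (Fin k) ℝ}
    (hA : A.IsHermitian) {μ : ℝ} (hμ : IsLeast (spectrum ℝ A) μ) (x : EuclideanSpace ℝ (Fin k)) :
    μ * ‖x‖ ^ 2 ≤ ⟪x, toEuclideanLin A x⟫ := by
  have hps : (A - algebraMap ℝ _ μ).PosSemidef := by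
    rw [posSemidef_iff_isHermitian_and_spectrum_nonneg]
    refine ⟨hA.sub ?_, ?_⟩
    · rw [IsHermitian, Algebra.algebraMap_eq_smul_one, conjTranspose_smul, conjTranspose_one]
      simp
    · intro a ha
      rw [← spectrum.sub_singleton_eq] at ha
      obtain ⟨c, hc, d, hd, rfl⟩ := ha
      rw [Set.mem_singleton_iff] at hd
      subst hd
      exact sub_nonneg.2 (hμ.2 hc)
  have := hps.dotProduct_mulVec_nonneg x.ofLp
  rw [Algebra.algebraMap_eq_smul_one, sub_mulVec, dotProduct_sub, smul_mulVec, one_mulVec,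
    dotProduct_smul] at this
  rw [inner_toEuclideanLin, ← real_inner_self_eq_norm_sq, EuclideanSpace.inner_eq_star_dotProduct]
  simpa using this

theorem saddleForm_of_matrix {n m : ℕ} {C : Matrix (Fin n) (Fin n) ℝ}
    {B : Matrix (Fin n) (Fin m) ℝ} {A : Matrix (Fin m) (Fin m) ℝ} {L μ l : ℝ}
    (hC : Cᵀ = C) (hA : A.PosDef) (hS : (C + B * A⁻¹ * Bᵀ).PosDef)
    (hAL : ‖A‖ ≤ L) (hBL : ‖B‖ ≤ L) (hCL : ‖C‖ ≤ L)
    (hμ : IsLeast (spectrum ℝ A) μ) (hl : IsLeast (spectrum ℝ (C + B * A⁻¹ * Bᵀ)) l) :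
    SaddleForm (toEuclideanLin C) (toEuclideanLin B) (toEuclideanLin Bᵀ) (toEuclideanLin A)
      L μ (min L l) := by
  have hAt : Aᵀ = A := hA.isHermitian
  have eig : ∀ {k : ℕ} {A : Matrix (Fin k) (Fin k) ℝ} {μ : ℝ}, A.PosDef → μ ∈ spectrum ℝ A →
      0 < μ := by
    intro k A μ hA h
    rw [hA.isHermitian.spectrum_real_eq_range_eigenvalues] at h
    obtain ⟨i, rfl⟩ := h
    exact hA.eigenvalues_pos i
  have hμ0 := eig hA hμ.1
  have hl0 := eig hS hl.1
  have hμL : μ ≤ L := by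
    -- A least eigenvalue exists, so the spectrum is nonempty, which rules out `m = 0`.
    have : Nonempty (Fin m) := by
      by_contra h
      rw [not_nonempty_iff] at h
      have := hμ.1
      rw [spectrum.of_subsingleton] at this
      exact this
    have h := spectrum.norm_le_norm_of_mem hμ.1
    exact (le_abs_self μ).trans (h.trans hAL)
  have hL : 0 < L := hμ0.trans_le hμL
  refine ⟨?_, ?_, ?_, ?_, ?_, ?_, ?_, ?_, hμ0, lt_min hL hl0, hμL, min_le_left _ _⟩
  · intro x x'
    rw [inner_toEuclideanLin_eq_transpose, hC]
  · intro x x'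
    rw [inner_toEuclideanLin_eq_transpose, hAt]
  · exact inner_toEuclideanLin_eq_transpose B
  · intro x
    refine (abs_inner_toEuclideanLin_le C x x).trans ?_
    rw [← sq]
    gcongr
  · intro x y
    refine (abs_inner_toEuclideanLin_le B x y).trans ?_
    gcongr
  · exact le_inner_toEuclideanLin_of_isLeast_spectrum hA.isHermitian hμ
  · intro y
    refine (le_abs_self _).trans ((abs_inner_toEuclideanLin_le A y y).trans ?_)
    rw [← sq]
    gcongr
  · intro x
    have hdet : IsUnit A.det := (isUnit_iff_isUnit_det A).1 hA.isUnit
    have hAh : toEuclideanLin A (toEuclideanLin (A⁻¹ * Bᵀ) x) = toEuclideanLin Bᵀ x := by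
      ext i
      simp [toLpLin_apply, mulVec_mulVec, mul_nonsing_inv_cancel_left _ _ hdet]
    refine ⟨toEuclideanLin (A⁻¹ * Bᵀ) x, hAh, ?_⟩
    have h1 := le_inner_toEuclideanLin_of_isLeast_spectrum hS.isHermitian hl x
    have h2 : ⟪toEuclideanLin (A⁻¹ * Bᵀ) x, toEuclideanLin Bᵀ x⟫
        = ⟪x, toEuclideanLin (B * A⁻¹ * Bᵀ) x⟫ := by
      rw [real_inner_comm, ← inner_toEuclideanLin_eq_transpose]
      simp [toLpLin_apply, mulVec_mulVec, Matrix.mul_assoc]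
    rw [hAh, h2, ← inner_add_right, ← LinearMap.add_apply, ← map_add]
    refine le_trans ?_ h1
    gcongr
    exact min_le_right _ _

end Blocks

open Matrix

/-! ### Eigenvectors and the norm adapted to the diagonalization -/

section Diagonalization

theorem map_ofReal_mulVec_re {ι : Type*} [Fintype ι] (M : Matrix ι ι ℝ) (v : ι → ℂ) (i : ι) :
    ((M.map Complex.ofReal *ᵥ v) i).re = (M *ᵥ fun j => (v j).re) i := by
  simp [mulVec, dotProduct]

theorem map_ofReal_mulVec_im {ι : Type*} [Fintype ι] (M : Matrix ι ι ℝ) (v : ι → ℂ) (i : ι) :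
    ((M.map Complex.ofReal *ᵥ v) i).im = (M *ᵥ fun j => (v j).im) i := by
  simp [mulVec, dotProduct]

theorem eigenvalue_bounds_of_matrix {n m : ℕ} {C : Matrix (Fin n) (Fin n) ℝ}
    {B : Matrix (Fin n) (Fin m) ℝ} {A : Matrix (Fin m) (Fin m) ℝ} {L μ μx r : ℝ}
    (S : SaddleForm (toEuclideanLin C) (toEuclideanLin B) (toEuclideanLin Bᵀ) (toEuclideanLin A)
      L μ μx) (hr : 2 * L ≤ r * μ) {v : Fin n ⊕ Fin m → ℂ} (hv : v ≠ 0) {l : ℂ}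
    (hl : (fromBlocks (-C) (-B) (r • Bᵀ) (-(r • A))).map Complex.ofReal *ᵥ v = l • v) :
    l.re ≤ -(μx / 2) ∧ -(r * L) ≤ l.re ∧ l.im ^ 2 ≤ 2 * r * L * (-l.re) := by
  have hre := fun i => (map_ofReal_mulVec_re _ v i).symm.trans
    (congrArg Complex.re (congrFun hl i))
  have him := fun i => (map_ofReal_mulVec_im _ v i).symm.trans
    (congrArg Complex.im (congrFun hl i))
  simp only [fromBlocks_mulVec, Pi.smul_apply, smul_eq_mul, Complex.mul_re, Complex.mul_im]
    at hre him
  refine S.eigenvalue_bounds hr (x := WithLp.toLp 2 fun i => (v (Sum.inl i)).re)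
    (x' := WithLp.toLp 2 fun i => (v (Sum.inl i)).im)
    (y := WithLp.toLp 2 fun i => (v (Sum.inr i)).re)
    (y' := WithLp.toLp 2 fun i => (v (Sum.inr i)).im) ?_ ?_ ?_ ?_ ?_
  · ext i
    have := hre (Sum.inl i)
    simp only [Sum.elim_inl, Pi.add_apply, neg_mulVec, Pi.neg_apply] at this
    simpa [toLpLin_apply, Function.comp_def, sub_eq_add_neg] using this
  · ext i
    have := (him (Sum.inl i)).trans (add_comm _ _)
    simp only [Sum.elim_inl, Pi.add_apply, neg_mulVec, Pi.neg_apply] at this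
    simpa [toLpLin_apply, Function.comp_def, sub_eq_add_neg] using this
  · ext i
    have := hre (Sum.inr i)
    simp only [Sum.elim_inr, Pi.add_apply, neg_mulVec, Pi.neg_apply, smul_mulVec,
      Pi.smul_apply, smul_eq_mul] at this
    simpa [toLpLin_apply, Function.comp_def, sub_eq_add_neg, mul_add] using this
  · ext i
    have := (him (Sum.inr i)).trans (add_comm _ _)
    simp only [Sum.elim_inr, Pi.add_apply, neg_mulVec, Pi.neg_apply, smul_mulVec,
      Pi.smul_apply, smul_eq_mul] at this
    simpa [toLpLin_apply, Function.comp_def, sub_eq_add_neg, mul_add] using this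
  · by_contra! h
    obtain ⟨⟨h1, h2⟩, h3, h4⟩ := h
    apply hv
    funext i
    rcases i with i | i
    · exact Complex.ext (congrFun (congrArg WithLp.ofLp h1) i)
        (congrFun (congrArg WithLp.ofLp h3) i)
    · exact Complex.ext (congrFun (congrArg WithLp.ofLp h2) i)
        (congrFun (congrArg WithLp.ofLp h4) i)

theorem norm_toLp_ofReal {ι : Type*} [Fintype ι] (v : EuclideanSpace ℝ ι) :
    ‖(WithLp.toLp 2 fun i => (v i : ℂ) : EuclideanSpace ℂ ι)‖ = ‖v‖ := by
  simp [EuclideanSpace.norm_eq]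

variable {ι : Type*} [Fintype ι] [DecidableEq ι]

theorem toEuclideanCLM_mul_apply {𝕜 : Type*} [RCLike 𝕜] (A B : Matrix ι ι 𝕜)
    (v : EuclideanSpace 𝕜 ι) : toEuclideanCLM (𝕜 := 𝕜) (A * B) v
      = toEuclideanCLM (𝕜 := 𝕜) A (toEuclideanCLM (𝕜 := 𝕜) B v) := by
  rw [map_mul]; rfl

/-- Complexification of a real vector followed by the change of basis `P`. -/
def eigenCoord (P : Matrix ι ι ℂ) : EuclideanSpace ℝ ι →+ EuclideanSpace ℂ ι where
  toFun v := toEuclideanCLM (𝕜 := ℂ) P (WithLp.toLp 2 fun i => (v i : ℂ))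
  map_zero' := by
    rw [← map_zero (toEuclideanCLM (𝕜 := ℂ) P)]
    congr 1
  map_add' u v := by
    rw [← map_add]
    congr 1
    ext i
    simp

theorem norm_eigenCoord_le (P : Matrix ι ι ℂ) (v : EuclideanSpace ℝ ι) :
    ‖eigenCoord P v‖ ≤ ‖P‖ * ‖v‖ := by
  rw [← norm_toLp_ofReal v]
  exact (toEuclideanCLM (𝕜 := ℂ) P).le_opNorm _

theorem norm_le_norm_eigenCoord {P : Matrix ι ι ℂ} (hP : IsUnit P) (v : EuclideanSpace ℝ ι) :
    ‖v‖ ≤ ‖P⁻¹‖ * ‖eigenCoord P v‖ := by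
  have hdet : IsUnit P.det := (isUnit_iff_isUnit_det P).1 hP
  have h : toEuclideanCLM (𝕜 := ℂ) P⁻¹ (eigenCoord P v) = WithLp.toLp 2 fun i => (v i : ℂ) := by
    change toEuclideanCLM (𝕜 := ℂ) P⁻¹ (toEuclideanCLM (𝕜 := ℂ) P _) = _
    rw [← toEuclideanCLM_mul_apply, nonsing_inv_mul _ hdet, map_one,
      one_apply_eq_self]
  rw [← norm_toLp_ofReal v, ← h]
  exact (toEuclideanCLM (𝕜 := ℂ) P⁻¹).le_opNorm _

/-- In the coordinates `P v` the matrix `K` acts as `diagonal θ`, whose operator norm is the largest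
`‖θ i‖`; no condition number enters. -/
theorem norm_eigenCoord_mulVec_le {P : Matrix ι ι ℂ} (hP : IsUnit P) {K : Matrix ι ι ℝ}
    {θ : ι → ℂ} (hK : K.map Complex.ofReal = P⁻¹ * diagonal θ * P) {ρ : ℝ} (hρ : 0 ≤ ρ)
    (hθ : ∀ i, ‖θ i‖ ≤ ρ) (v : EuclideanSpace ℝ ι) :
    ‖eigenCoord P (toEuclideanCLM (𝕜 := ℝ) K v)‖ ≤ ρ * ‖eigenCoord P v‖ := by
  have hdet : IsUnit P.det := (isUnit_iff_isUnit_det P).1 hP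
  have h1 : (WithLp.toLp 2 fun i => ((toEuclideanCLM (𝕜 := ℝ) K v) i : ℂ) : EuclideanSpace ℂ ι)
      = toEuclideanCLM (𝕜 := ℂ) (K.map Complex.ofReal) (WithLp.toLp 2 fun i => (v i : ℂ)) := by
    ext i
    simp [ofLp_toEuclideanCLM, mulVec, dotProduct]
  have h2 : eigenCoord P (toEuclideanCLM (𝕜 := ℝ) K v)
      = toEuclideanCLM (𝕜 := ℂ) (diagonal θ) (eigenCoord P v) := by
    change toEuclideanCLM (𝕜 := ℂ) P (WithLp.toLp 2 _) =
      toEuclideanCLM (𝕜 := ℂ) (diagonal θ) (toEuclideanCLM (𝕜 := ℂ) P _)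
    rw [h1, ← toEuclideanCLM_mul_apply, ← toEuclideanCLM_mul_apply, hK,
      Matrix.mul_assoc, mul_nonsing_inv_cancel_left _ _ hdet]
  rw [h2]
  refine ((toEuclideanCLM (𝕜 := ℂ) (diagonal θ)).le_opNorm _).trans ?_
  gcongr
  rw [l2_opNorm_toEuclideanCLM, l2_opNorm_diagonal]
  exact (pi_norm_le_iff_of_nonneg hρ).2 hθ

theorem mulVec_eigenvector {P : Matrix ι ι ℂ} (hP : IsUnit P) {M : Matrix ι ι ℂ} {θ : ι → ℂ}
    (hM : M = P⁻¹ * diagonal θ * P) (i : ι) : ∃ v ≠ 0, M *ᵥ v = θ i • v := by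
  have hdet : IsUnit P.det := (isUnit_iff_isUnit_det P).1 hP
  have hPv : P *ᵥ (P⁻¹ *ᵥ Pi.single i 1) = Pi.single i 1 := by
    rw [mulVec_mulVec, mul_nonsing_inv _ hdet, one_mulVec]
  refine ⟨P⁻¹ *ᵥ Pi.single i 1, fun h => ?_, ?_⟩
  · rw [h, mulVec_zero] at hPv
    simpa using congrFun hPv i
  · rw [hM, ← mulVec_mulVec, hPv, ← mulVec_mulVec, ← mulVec_smul]
    congr 1
    simp only [mulVec_single, MulOpposite.op_one, one_smul]
    ext j
    by_cases h : j = i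
    · subst h; simp
    · simp [h]

theorem one_add_smul_eq_diagonal {P : Matrix ι ι ℂ} (hP : IsUnit P) {M : Matrix ι ι ℝ}
    {θ : ι → ℂ} (hM : M.map Complex.ofReal = P⁻¹ * diagonal θ * P) :
    (1 + M).map Complex.ofReal = P⁻¹ * diagonal (fun i => 1 + θ i) * P ∧
    (1 + M * (1 + M)).map Complex.ofReal
      = P⁻¹ * diagonal (fun i => 1 + θ i * (1 + θ i)) * P := by
  have hdet : IsUnit P.det := (isUnit_iff_isUnit_det P).1 hP
  have h1 : (1 + M).map Complex.ofReal = P⁻¹ * diagonal (fun i => 1 + θ i) * P := by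
    have : diagonal (fun i => 1 + θ i) = 1 + diagonal θ := by
      rw [← diagonal_one, diagonal_add]
    rw [this, mul_add, add_mul, mul_one, nonsing_inv_mul _ hdet, ← hM,
      Matrix.map_add _ Complex.ofReal_add, Matrix.map_one _ Complex.ofReal_zero Complex.ofReal_one]
  refine ⟨h1, ?_⟩
  have : diagonal (fun i => 1 + θ i * (1 + θ i))
      = 1 + diagonal θ * diagonal (fun i => 1 + θ i) := by
    rw [diagonal_mul_diagonal, ← diagonal_one, diagonal_add]
  have hmul : (M * (1 + M)).map Complex.ofReal
      = M.map Complex.ofReal * (1 + M).map Complex.ofReal :=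
    Matrix.map_mul (f := Complex.ofRealHom)
  rw [this, Matrix.map_add _ Complex.ofReal_add,
    Matrix.map_one _ Complex.ofReal_zero Complex.ofReal_one, hmul, h1, hM, mul_add P⁻¹,
    add_mul _ _ P, mul_one, nonsing_inv_mul _ hdet]
  congr 1
  simp only [Matrix.mul_assoc]
  rw [mul_nonsing_inv_cancel_left _ _ hdet]

end Diagonalization

theorem hasFDerivAt_id_add_clm_comp {E : Type*} [NormedAddCommGroup E] [NormedSpace ℝ E]
    {g : E → E} {H : E →L[ℝ] E} {x : E} (W : E →L[ℝ] E) (hg : HasFDerivAt g H x) :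
    HasFDerivAt (fun z => z + W (g z)) (1 + W * H) x :=
  (hasFDerivAt_id x).add (W.hasFDerivAt.comp x hg)

/-! ### Hessian and Jacobians of the two step maps -/

section Gradient

variable {n m : ℕ} {f : Point n m → ℝ} {zs : Point n m}

theorem gradient_eq_toDual_symm (f : Point n m → ℝ) :
    gradient f = fun z => (InnerProductSpace.toDual ℝ (Point n m)).symm (fderiv ℝ f z) := rfl

theorem differentiableAt_gradient (hf : ContDiffAt ℝ 2 f zs) :
    DifferentiableAt ℝ (gradient f) zs := by
  have h : DifferentiableAt ℝ (fderiv ℝ f) zs :=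
    (hf.fderiv_right (m := 1) (by norm_num)).differentiableAt (by norm_num)
  rw [gradient_eq_toDual_symm]
  exact (InnerProductSpace.toDual ℝ
    (Point n m)).symm.toContinuousLinearEquiv.differentiableAt.comp zs h

/-- Links the Jacobian of the gradient to the second derivative of `f`, whose symmetry then yields
that of `hess`. -/
theorem fderiv_gradient_apply (hf : ContDiffAt ℝ 2 f zs) (u : Point n m)
    (i : Fin n ⊕ Fin m) : fderiv ℝ (gradient f) zs u i
      = fderiv ℝ (fderiv ℝ f) zs u (EuclideanSpace.single i 1) := by
  have h : DifferentiableAt ℝ (fderiv ℝ f) zs :=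
    (hf.fderiv_right (m := 1) (by norm_num)).differentiableAt (by norm_num)
  have hcoord : (fun z => gradient f z i)
      = fun z => fderiv ℝ f z (EuclideanSpace.single i 1) := by
    funext z
    have := EuclideanSpace.inner_single_right (𝕜 := ℝ) i 1 (gradient f z)
    rw [gradient_eq_toDual_symm, InnerProductSpace.toDual_symm_apply] at this
    rw [gradient_eq_toDual_symm]
    simpa using this.symm
  have h1 : HasFDerivAt (fun z => gradient f z i)
      ((EuclideanSpace.proj i).comp (fderiv ℝ (gradient f) zs)) zs :=
    (EuclideanSpace.proj i : Point n m →L[ℝ] ℝ).hasFDerivAt.comp zs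
      (differentiableAt_gradient hf).hasFDerivAt
  have h2 := h.hasFDerivAt.clm_apply
    (hasFDerivAt_const (EuclideanSpace.single i (1 : ℝ) : Point n m) zs)
  rw [hcoord] at h1
  have := congrArg (fun T : Point n m →L[ℝ] ℝ => T u) (h1.unique h2)
  simpa using this

theorem hess_transpose (hf : ContDiffAt ℝ 2 f zs) : (hess f zs)ᵀ = hess f zs := by
  ext i j
  simp only [hess, transpose_apply, of_apply, fderiv_gradient_apply hf]
  exact hf.isSymmSndFDerivAt (by simp) _ _

theorem hess_eq_fromBlocks (hf : ContDiffAt ℝ 2 f zs) :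
    hess f zs = fromBlocks (blockC f zs) (blockB f zs) (blockB f zs)ᵀ (-blockA f zs) := by
  have h : (hess f zs).toBlocks₂₁ = (blockB f zs)ᵀ := by
    ext i j
    exact (congrFun (congrFun (hess_transpose hf) (Sum.inr i)) (Sum.inl j)).symm
  rw [← h, blockA, neg_neg]
  exact (fromBlocks_toBlocks _).symm

theorem blockC_transpose (hf : ContDiffAt ℝ 2 f zs) : (blockC f zs)ᵀ = blockC f zs := by
  ext i j
  exact congrFun (congrFun (hess_transpose hf) (Sum.inl i)) (Sum.inl j)

theorem hasFDerivAt_gradient (hf : ContDiffAt ℝ 2 f zs) :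
    HasFDerivAt (gradient f) (toEuclideanCLM (𝕜 := ℝ) (hess f zs)) zs := by
  have h : fderiv ℝ (gradient f) zs = toEuclideanCLM (𝕜 := ℝ) (hess f zs) := by
    refine ContinuousLinearMap.coe_injective ((EuclideanSpace.basisFun _ ℝ).toBasis.ext ?_)
    intro j
    ext i
    simp [hess, ofLp_toEuclideanCLM]
  rw [← h]
  exact (differentiableAt_gradient hf).hasFDerivAt

theorem gradient_eq_zero (h : IsDifferentialStackelberg f zs) : gradient f zs = 0 := by
  ext i
  rcases i with i | i
  · exact congrFun (congrArg WithLp.ofLp h.gradX_eq_zero) i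
  · exact congrFun (congrArg WithLp.ofLp h.gradY_eq_zero) i

/-- The matrix of step sizes: `-ηx` on `x`, `ηy` on `y`. -/
def stepMatrix (n m : ℕ) (ηx ηy : ℝ) : Matrix (Fin n ⊕ Fin m) (Fin n ⊕ Fin m) ℝ :=
  diagonal (Sum.elim (fun _ => -ηx) fun _ => ηy)

theorem stepAlong_eq (f : Point n m → ℝ) (ηx ηy : ℝ) (z w : Point n m) :
    stepAlong f ηx ηy z w
      = z + toEuclideanCLM (𝕜 := ℝ) (stepMatrix n m ηx ηy) (gradient f w) := by
  ext i
  rcases i with i | i <;>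
    simp [stepAlong, stepMatrix, gradX, gradY, ofLp_toEuclideanCLM, mulVec_diagonal,
      sub_eq_add_neg]

/-- The ratio `r` of the two step sizes is what turns the Hessian into `M`. -/
theorem stepMatrix_mul_hess (hf : ContDiffAt ℝ 2 f zs) (η r : ℝ) :
    stepMatrix n m η (r * η) * hess f zs = η • dynMatrix f zs r := by
  rw [hess_eq_fromBlocks hf, dynMatrix, fromBlocks_smul]
  have : stepMatrix n m η (r * η)
      = fromBlocks (diagonal fun _ => -η) 0 0 (diagonal fun _ => r * η) := by
    rw [fromBlocks_diagonal]; rfl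
  rw [this, fromBlocks_multiply]
  congr 1 <;> ext i j <;> simp [diagonal_mul] <;> ring

theorem stepAlong_self (h : gradient f zs = 0) (ηx ηy : ℝ) : stepAlong f ηx ηy zs zs = zs := by
  rw [stepAlong_eq, h, map_zero, add_zero]

theorem toEuclideanCLM_smul_dynMatrix (hf : ContDiffAt ℝ 2 f zs) (η r : ℝ) :
    toEuclideanCLM (𝕜 := ℝ) (η • dynMatrix f zs r)
      = toEuclideanCLM (𝕜 := ℝ) (stepMatrix n m η (r * η))
        * toEuclideanCLM (𝕜 := ℝ) (hess f zs) := by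
  rw [← stepMatrix_mul_hess hf, map_mul]

theorem hasFDerivAt_gda (hf : ContDiffAt ℝ 2 f zs) (η r : ℝ) :
    HasFDerivAt (fun z => stepAlong f η (r * η) z z)
      (toEuclideanCLM (𝕜 := ℝ) (1 + η • dynMatrix f zs r)) zs := by
  rw [map_add, map_one, toEuclideanCLM_smul_dynMatrix hf,
    funext fun z => stepAlong_eq f η (r * η) z z]
  exact hasFDerivAt_id_add_clm_comp _ (hasFDerivAt_gradient hf)

theorem hasFDerivAt_eg (hf : ContDiffAt ℝ 2 f zs) (h : gradient f zs = 0) (η r : ℝ) :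
    HasFDerivAt (fun z => stepAlong f η (r * η) z (egHalf f η (r * η) z))
      (toEuclideanCLM (𝕜 := ℝ)
        (1 + (η • dynMatrix f zs r) * (1 + η • dynMatrix f zs r))) zs := by
  have hgrad : HasFDerivAt (gradient f) (toEuclideanCLM (𝕜 := ℝ) (hess f zs))
      (stepAlong f η (r * η) zs zs) := by
    rw [stepAlong_self h]; exact hasFDerivAt_gradient hf
  rw [map_add, map_one, map_mul, toEuclideanCLM_smul_dynMatrix hf, mul_assoc,
    funext fun z => stepAlong_eq f η (r * η) z (egHalf f η (r * η) z)]
  exact hasFDerivAt_id_add_clm_comp _ (HasFDerivAt.comp (f := egHalf f η (r * η)) zs hgrad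
    (hasFDerivAt_gda hf η r))

end Gradient

/-! ### Contraction rates and oracle counts -/

/-- Both step maps contract linearly, in the coordinates given by `P`. -/
theorem multiplier_bounds {L μx r : ℝ} {l : ℂ} (hL : 0 < L) (hμx : 0 < μx) (hr : 0 < r)
    (h1 : l.re ≤ -(μx / 2)) (h2 : -(r * L) ≤ l.re) (h3 : l.im ^ 2 ≤ 2 * r * L * (-l.re)) :
    ‖1 + ((1 / (4 * r * L) : ℝ) : ℂ) * l‖ ≤ 1 - 1 / 16 / (r * (L / μx)) ∧
    ‖1 + ((1 / (4 * r * L) : ℝ) : ℂ) * l * (1 + ((1 / (4 * r * L) : ℝ) : ℂ) * l)‖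
      ≤ 1 - 1 / 16 / (r * (L / μx)) := by
  set η : ℝ := 1 / (4 * r * L) with hη
  have hη0 : 0 < η := by positivity
  have hηrL : η * (r * L) = 1 / 4 := by rw [hη]; field_simp
  set t : ℝ := η * (-l.re) with ht
  have hre : ((η : ℂ) * l).re = -t := by simp [ht]
  have him : ((η : ℂ) * l).im = η * l.im := by simp
  -- `-l.re ≥ μx / 2` gives `t ≥ μx / (8 * r * L)`, and the multiplier bounds lose another factor of
  -- two.
  have ht0 : 1 / 16 / (r * (L / μx)) ≤ t / 2 := by
    have e : 1 / 16 / (r * (L / μx)) = η * (μx / 2) / 2 := by rw [hη]; field_simp; norm_num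
    rw [e, ht]
    gcongr
    linarith
  have hpos : 0 ≤ t := mul_nonneg hη0.le (by linarith)
  have ht1 : t ≤ 1 / 4 := by
    rw [← hηrL, ht]
    gcongr
    linarith
  have hq : ((η : ℂ) * l).im ^ 2 ≤ t / 2 := by
    rw [him, mul_pow]
    calc η ^ 2 * l.im ^ 2 ≤ η ^ 2 * (2 * r * L * (-l.re)) := by gcongr
      _ = 2 * (η * (r * L)) * t := by rw [ht]; ring
      _ = t / 2 := by rw [hηrL]; ring
  exact ⟨(norm_one_add_le hre hpos ht1 hq).trans (by linarith),
    (norm_one_add_add_sq_le hre hpos ht1 hq).trans (by linarith)⟩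

theorem gdaRun_calls {n m : ℕ} (f : Point n m → ℝ) (ηx ηy : ℝ) (z : Point n m) (T : ℕ) :
    (gdaRun f ηx ηy z T).calls = T := by
  induction T with
  | zero => rfl
  | succ T ih => simp [gdaRun, ih]

theorem egRun_calls {n m : ℕ} (f : Point n m → ℝ) (ηx ηy : ℝ) (z : Point n m) (T : ℕ) :
    (egRun f ηx ηy z T).calls = 2 * T := by
  induction T with
  | zero => rfl
  | succ T ih => simp [egRun, ih, mul_add]

end Minimax

end

/-- `c₀` and `K` are numerical constants. `D` is the domain of `f`, a neighbourhood of `zs`;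
`P` is a complex matrix that diagonalizes `M`, and `CP` is its condition number. The iterates, and
all points where the gradient is queried, stay in the interior of `D`. -/
theorem theorem2 :
    ∃ c₀ K : ℝ, 0 < c₀ ∧ c₀ < 1 ∧ 0 < K ∧
      ∀ (n m : ℕ) (D : Set (Minimax.Point n m)) (f : Minimax.Point n m → ℝ)
        (zs : Minimax.Point n m) (L μ μx r κ κx ηx ηy : ℝ),
        D ∈ 𝓝 zs →
        ContDiffOn ℝ 2 f D →
        Minimax.IsStackelbergWith f zs L μ μx →
        κ = L / μ → κx = L / μx →
        2 * κ ≤ r →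
        ηx = 1 / (4 * r * L) → ηy = 1 / (4 * L) →
        ∀ (P : Matrix (Fin n ⊕ Fin m) (Fin n ⊕ Fin m) ℂ) (Λ : Fin n ⊕ Fin m → ℂ) (CP : ℝ),
          IsUnit P →
          (Minimax.dynMatrix f zs r).map Complex.ofReal = P⁻¹ * Matrix.diagonal Λ * P →
          CP = ‖P‖ * ‖P⁻¹‖ →
          ∃ δ : ℝ, 0 < δ ∧ ∀ z₀ : Minimax.Point n m, ‖z₀ - zs‖ ≤ δ →
            ((∀ T : ℕ, (Minimax.gdaRun f ηx ηy z₀ T).point ∈ interior D) ∧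
              (∀ T : ℕ,
                ‖(Minimax.gdaRun f ηx ηy z₀ T).point - zs‖
                  ≤ CP * ‖z₀ - zs‖ * (1 - c₀ / (r * κx)) ^ T) ∧
              (∀ ε : ℝ, 0 < ε → ∃ T : ℕ,
                ((Minimax.gdaRun f ηx ηy z₀ T).calls : ℝ)
                    ≤ K * max 1 (r * κx * Real.log (CP * ‖z₀ - zs‖ / ε)) ∧
                ∀ T' : ℕ, T ≤ T' → ‖(Minimax.gdaRun f ηx ηy z₀ T').point - zs‖ < ε)) ∧
            ((∀ T : ℕ, (Minimax.egRun f ηx ηy z₀ T).point ∈ interior D ∧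
                Minimax.egHalf f ηx ηy (Minimax.egRun f ηx ηy z₀ T).point ∈ interior D) ∧
              (∀ T : ℕ,
                ‖(Minimax.egRun f ηx ηy z₀ T).point - zs‖
                  ≤ CP * ‖z₀ - zs‖ * (1 - c₀ / (r * κx)) ^ T) ∧
              (∀ ε : ℝ, 0 < ε → ∃ T : ℕ,
                ((Minimax.egRun f ηx ηy z₀ T).calls : ℝ)
                    ≤ K * max 1 (r * κx * Real.log (CP * ‖z₀ - zs‖ / ε)) ∧
                ∀ T' : ℕ, T ≤ T' → ‖(Minimax.egRun f ηx ηy z₀ T').point - zs‖ < ε)) := by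
  -- `1 / 32` is half of the spectral constant `1 / 16`; the other half absorbs the nonlinear
  -- remainder. The iteration bound has constant `1 / c₀ + 1 = 33`, doubled for the two queries of
  -- EG.
  refine ⟨1 / 32, 66, by norm_num, by norm_num, by norm_num, ?_⟩
  intro n m D f zs L μ μx r κ κx ηx ηy hD hfD hS hκ hκx hr hηx hηy P Λ CP hP hM hCP
  obtain ⟨hst, hsm, hμ, l, hl, rfl⟩ := hS
  have hf : ContDiffAt ℝ 2 f zs := hfD.contDiffAt hD
  have S := Minimax.saddleForm_of_matrix (Minimax.blockC_transpose hf) hst.posDef_A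
    hst.posDef_schur ((le_max_left _ _).trans hsm)
    ((le_max_left _ _).trans ((le_max_right _ _).trans hsm))
    ((le_max_right _ _).trans ((le_max_right _ _).trans hsm)) hμ hl
  set μx := min L l
  have hμ0 := S.mu_pos
  have hμx0 := S.mux_pos
  have hL : 0 < L := hμ0.trans_le S.mu_le
  have hrL : 2 * L ≤ r * μ := by
    rw [hκ, ← mul_div_assoc, div_le_iff₀ hμ0] at hr
    exact hr
  have hκ1 : 1 ≤ κ := by rw [hκ, one_le_div hμ0]; exact S.mu_le
  have hκx1 : 1 ≤ κx := by rw [hκx, one_le_div hμx0]; exact S.mux_le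
  have hr0 : 0 < r := by linarith
  have hq : 2 ≤ r * κx := by nlinarith
  have hηyx : ηy = r * ηx := by rw [hηx, hηy]; field_simp
  have hgrad := Minimax.gradient_eq_zero hst
  have hmult : ∀ i, ‖1 + (ηx : ℂ) * Λ i‖ ≤ 1 - 1 / 16 / (r * κx) ∧
      ‖1 + (ηx : ℂ) * Λ i * (1 + (ηx : ℂ) * Λ i)‖ ≤ 1 - 1 / 16 / (r * κx) := by
    intro i
    rw [hηx, hκx]
    obtain ⟨v, hv, hMv⟩ := Minimax.mulVec_eigenvector hP hM i
    obtain ⟨h1, h2, h3⟩ := Minimax.eigenvalue_bounds_of_matrix S hrL hv hMv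
    exact Minimax.multiplier_bounds hL hμx0 hr0 h1 h2 h3
  have hηM : (ηx • Minimax.dynMatrix f zs r).map Complex.ofReal
      = P⁻¹ * Matrix.diagonal (fun i => (ηx : ℂ) * Λ i) * P := by
    have h1 : (ηx • Minimax.dynMatrix f zs r).map Complex.ofReal
        = (ηx : ℂ) • (Minimax.dynMatrix f zs r).map Complex.ofReal := by
      ext i j
      simp
    have h2 : Matrix.diagonal (fun i => (ηx : ℂ) * Λ i) = (ηx : ℂ) • Matrix.diagonal Λ := by
      rw [← Matrix.diagonal_smul]; rfl
    rw [h1, h2, hM, Matrix.mul_smul, Matrix.smul_mul]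
  obtain ⟨hgK, heK⟩ := Minimax.one_add_smul_eq_diagonal hP hηM
  -- This makes the linear rate nonnegative, as required of a bound on the moduli.
  have hx : 1 / 16 / (r * κx) ≤ 1 / 32 := by
    rw [div_le_iff₀ (by linarith)]
    linarith
  have hρ : 1 - 1 / 16 / (r * κx) < 1 - 1 / 32 / (r * κx) := by
    gcongr
    norm_num
  have hx0 : 0 < 1 / 32 / (r * κx) := by positivity
  have hgda := Minimax.hasFDerivAt_gda hf ηx r
  have heg := Minimax.hasFDerivAt_eg hf hgrad ηx r
  rw [← hηyx] at hgda heg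
  have hfix := Minimax.stepAlong_self hgrad ηx ηy
  have hfix' : Minimax.stepAlong f ηx ηy zs (Minimax.egHalf f ηx ηy zs) = zs := by
    rw [Minimax.egHalf, hfix, hfix]
  have hU : interior D ∈ 𝓝 zs := interior_mem_nhds.2 hD
  -- For EG the half-step must stay in the domain too; it depends continuously on the iterate and
  -- fixes `zs`.
  have hU' : {z | z ∈ interior D ∧ Minimax.egHalf f ηx ηy z ∈ interior D} ∈ 𝓝 zs := by
    have hc : ContinuousAt (Minimax.egHalf f ηx ηy) zs := hgda.continuousAt
    have hhalf : Minimax.egHalf f ηx ηy ⁻¹' interior D ∈ 𝓝 zs := by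
      refine hc.preimage_mem_nhds ?_
      rw [Minimax.egHalf, hfix]
      exact hU
    exact Filter.inter_mem hU hhalf
  obtain ⟨δ₁, hδ₁, H₁⟩ := Minimax.exists_local_linear_convergence
    (Φ := fun z => Minimax.stepAlong f ηx ηy z z) hfix hgda (norm_nonneg P)
    (norm_nonneg P⁻¹) (Minimax.norm_eigenCoord_le P) (Minimax.norm_le_norm_eigenCoord hP)
    (Minimax.norm_eigenCoord_mulVec_le hP hgK (by linarith) fun i => (hmult i).1) hρ
    (by linarith) (by linarith) hU
  obtain ⟨δ₂, hδ₂, H₂⟩ := Minimax.exists_local_linear_convergence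
    (Φ := fun z => Minimax.stepAlong f ηx ηy z (Minimax.egHalf f ηx ηy z)) hfix' heg (norm_nonneg P)
    (norm_nonneg P⁻¹) (Minimax.norm_eigenCoord_le P) (Minimax.norm_le_norm_eigenCoord hP)
    (Minimax.norm_eigenCoord_mulVec_le hP heK (by linarith) fun i => (hmult i).2) hρ
    (by linarith) (by linarith) hU'
  rw [← hCP] at H₁ H₂
  refine ⟨min δ₁ δ₂, lt_min hδ₁ hδ₂, fun z₀ hz₀ => ⟨?_, ?_⟩⟩
  · have H := H₁ (fun k => (Minimax.gdaRun f ηx ηy z₀ k).point) (fun _ => rfl)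
      (hz₀.trans (min_le_left _ _))
    refine ⟨fun T => (H T).1, fun T => (H T).2, fun ε hε => ?_⟩
    obtain ⟨T, hT, hT'⟩ := Minimax.exists_iteration_bound (by norm_num) (by norm_num)
      (by linarith) (fun T => (H T).2) hε
    refine ⟨T, ?_, hT'⟩
    rw [Minimax.gdaRun_calls]
    have hz : (Minimax.gdaRun f ηx ηy z₀ 0).point = z₀ := rfl
    simp only [hz] at hT
    have := le_max_left 1 (r * κx * Real.log (CP * ‖z₀ - zs‖ / ε))
    linarith
  · have H := H₂ (fun k => (Minimax.egRun f ηx ηy z₀ k).point) (fun _ => rfl)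
      (hz₀.trans (min_le_right _ _))
    refine ⟨fun T => (H T).1, fun T => (H T).2, fun ε hε => ?_⟩
    obtain ⟨T, hT, hT'⟩ := Minimax.exists_iteration_bound (by norm_num) (by norm_num)
      (by linarith) (fun T => (H T).2) hε
    refine ⟨T, ?_, hT'⟩
    rw [Minimax.egRun_calls]
    push_cast
    have hz : (Minimax.egRun f ηx ηy z₀ 0).point = z₀ := rfl
    simp only [hz] at hT
    linarith
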